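/- Let $\Omega\subset\mathbb{R}^n$ be a smoothly bounded open set, i.e. $\Omega=\{x\in\mathbb{R}^n: r(x)<0\}$ for some $C^\infty$ function $r:\mathbb{R}^n\to\mathbb{R}$ with $\{r=0\}=b\Omega$ (the topological boundary) and $\nabla r\neq 0$ in a neighborhood of $b\Omega$. Let $p\in b\Omega$ and let $U\subset\mathbb{R}^n$ be an open neighborhood of $p$. For a $C^2$ function $f$ write $H_f(\xi,\zeta)(x)=\sum_{j,k=1}^n\frac{\partial^2 f}{\partial x_j\partial x_k}(x)\,\xi_j\zeta_k$. Suppose that $\Omega$ is convex in $U$, in the sense that for some local defining function $\rho$ of $\Omega$ on $U$ (that is, $\rho\in C^\infty(U)$, $\Omega\cap U=\{x\in U:\rho(x)<0\}$ and $\nabla\rho\neq 0$ on $b\Omega\cap U$) one has $$H_\rho(\xi,\xi)(q)\ge 0\qquad\text{for all } q\in b\Omega\cap U \text{ and all } \xi\in\mathbb{R}^n \text{ with } \langle\nabla\rho(q),\xi\rangle=0 .$$ Let $\delta$ be the signed distance to the boundary: $\delta(x)=-\inf_{z\in b\Omega}\|x-z\|$ for $x\in\Omega$ and $\delta(x)=\inf_{z\in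 b\Omega}\|x-z\|$ for $x\in\mathbb{R}^n\setminus\Omega$. Then $\delta$ is $C^\infty$ on an open set containing $b\Omega\cap U$, and $\delta$ is convex on $b\Omega\cap U$ in the sense that $$H_\delta(\xi,\xi)(x)\ge 0\qquad\text{for all } x\in b\Omega\cap U \text{ and all } \xi\in\mathbb{R}^n .$$ -/

import Mathlib

open scoped ContDiff

/-- `ℝⁿ` with the Euclidean norm. -/
abbrev Eucl (n : ℕ) : Type := EuclideanSpace ℝ (Fin n)

/-- The partial derivative `∂f/∂x_j`. -/
noncomputable def partialDeriv {n : ℕ} (j : Fin n) (f : Eucl n → ℝ) (x : Eucl n) : ℝ :=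
  fderiv ℝ f x (EuclideanSpace.single j 1)

/-- The real Hessian `H_f(ξ, ζ)(x) = ∑_{j,k} ∂²f/∂x_j∂x_k(x) ξ_j ζ_k`. -/
noncomputable def realHessian {n : ℕ} (f : Eucl n → ℝ) (ξ ζ : Eucl n) (x : Eucl n) : ℝ :=
  ∑ j : Fin n, ∑ k : Fin n, partialDeriv j (partialDeriv k f) x * ξ j * ζ k

/-- The open set `Ω` is smoothly bounded: it is `{r < 0}` for a `C^∞` function `r` on `ℝⁿ` with
`{r = 0} = bΩ` and with nowhere vanishing gradient in a neighborhood of `bΩ`. -/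
def IsSmoothlyBounded {n : ℕ} (Ω : Set (Eucl n)) : Prop :=
  IsOpen Ω ∧ ∃ r : Eucl n → ℝ, ContDiff ℝ ∞ r ∧ Ω = {x | r x < 0} ∧ {x | r x = 0} = frontier Ω ∧
    ∃ W : Set (Eucl n), IsOpen W ∧ frontier Ω ⊆ W ∧ ∀ x ∈ W, gradient r x ≠ 0

/-- `r` is a (smooth, nondegenerate) local defining function for `Ω` on the open set `U`. Only the
values of `r` on `U` matter. -/
def IsLocalDefiningFunction {n : ℕ} (Ω U : Set (Eucl n)) (r : Eucl n → ℝ) : Prop :=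
  ContDiffOn ℝ ∞ r U ∧ Ω ∩ U = {x | x ∈ U ∧ r x < 0} ∧ ∀ x ∈ frontier Ω ∩ U, gradient r x ≠ 0

/-- The tangent space at `x` of the boundary, described by a local defining function `r`:
the `ξ` with `⟨∇r(x), ξ⟩ = 0`. -/
def boundaryTangentSpace {n : ℕ} (r : Eucl n → ℝ) (x : Eucl n) : Set (Eucl n) :=
  {ξ | inner ℝ (gradient r x) ξ = 0}

/-- `Ω` is convex in the open set `U`: the Hessian of a local defining function on `U` is nonnegative
in all directions tangent to `bΩ`, at all points of `U ∩ bΩ`. The tangential sign condition does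
not depend on the local defining function, so that asking for one of them is enough. -/
def IsConvexDomainIn {n : ℕ} (Ω U : Set (Eucl n)) : Prop :=
  ∃ r : Eucl n → ℝ, IsLocalDefiningFunction Ω U r ∧
    ∀ q ∈ U ∩ frontier Ω, ∀ ξ ∈ boundaryTangentSpace r q, 0 ≤ realHessian r ξ ξ q

open Classical in
/-- The signed distance to the boundary: `-d(x, bΩ)` on `Ω` and `d(x, bΩ)` off `Ω`. -/
noncomputable def signedBoundaryDist {n : ℕ} (Ω : Set (Eucl n)) (x : Eucl n) : ℝ :=
  if x ∈ Ω then -Metric.infDist x (frontier Ω) else Metric.infDist x (frontier Ω)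

open scoped Topology
open Filter

/-! Near a boundary point `normalMap` is a local diffeomorphism, and Lagrange multipliers put each
nearby point on the normal through its nearest boundary point. So δ is the normal coordinate times
`‖∇r‖`, hence smooth.

For the Hessian, `‖∇δ‖ ≤ 1` everywhere while δ has derivative one along the unit normal ν at the
boundary, so the Hessian annihilates ν (`fderiv_fderiv_eq_zero_of_fderiv_eq_one`). Only tangential
directions remain. There the sign comes from ρ, because δ < 0 forces ρ < 0 near the point: if it
failed, a parabola bent slightly outward would run through points with δ < 0 < ρ
(`fderiv_fderiv_nonneg_of_tangential`). Comparing signs avoids factoring ρ through δ. -/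

lemma realHessian_eq_fderiv_fderiv {n : ℕ} {f : Eucl n → ℝ} {x : Eucl n}
    (hf : ContDiffAt ℝ 2 f x) (ξ ζ : Eucl n) :
    realHessian f ξ ζ x = fderiv ℝ (fderiv ℝ f) x ξ ζ := by
  have hd : DifferentiableAt ℝ (fderiv ℝ f) x :=
    (hf.fderiv_right (m := 1) (by norm_num)).differentiableAt (by norm_num)
  have hp (j k : Fin n) : partialDeriv j (partialDeriv k f) x =
      fderiv ℝ (fderiv ℝ f) x (EuclideanSpace.single j 1) (EuclideanSpace.single k 1) := by
    have h := (hd.hasFDerivAt.clm_apply (hasFDerivAt_const (EuclideanSpace.single k (1 : ℝ)) x)).fderiv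
    change fderiv ℝ (fun y => fderiv ℝ f y (EuclideanSpace.single k 1)) x _ = _
    rw [h]
    simp
  have hsum (v : Eucl n) : v = ∑ j, v j • EuclideanSpace.single j (1 : ℝ) := by
    have := (EuclideanSpace.basisFun (Fin n) ℝ).sum_repr v
    simpa using this.symm
  conv_rhs => rw [hsum ξ, hsum ζ]
  simp only [realHessian, hp, map_sum, map_smul, sum_apply,
    smul_apply, smul_eq_mul, Finset.mul_sum]
  rw [Finset.sum_comm]
  exact Finset.sum_congr rfl fun _ _ => Finset.sum_congr rfl fun _ _ => by ring

/-! ### Elementary properties of the signed distance -/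

lemma signedBoundaryDist_of_mem_frontier {n : ℕ} {Ω : Set (Eucl n)} {x : Eucl n}
    (hx : x ∈ frontier Ω) : signedBoundaryDist Ω x = 0 := by
  simp [signedBoundaryDist, Metric.infDist_zero_of_mem hx]

lemma abs_signedBoundaryDist {n : ℕ} (Ω : Set (Eucl n)) (x : Eucl n) :
    |signedBoundaryDist Ω x| = Metric.infDist x (frontier Ω) := by
  unfold signedBoundaryDist
  split_ifs <;> simp [abs_of_nonneg Metric.infDist_nonneg]

lemma mem_of_signedBoundaryDist_neg {n : ℕ} {Ω : Set (Eucl n)} {x : Eucl n}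
    (h : signedBoundaryDist Ω x < 0) : x ∈ Ω := by
  by_contra hx
  rw [signedBoundaryDist, if_neg hx] at h
  exact absurd Metric.infDist_nonneg h.not_ge

/-- The unsigned distance is 1-Lipschitz, and off the boundary the sign is locally constant; at a
boundary point δ vanishes, so the sign is irrelevant. -/
lemma norm_fderiv_signedBoundaryDist_le_one {n : ℕ} (Ω : Set (Eucl n)) (x : Eucl n) :
    ‖fderiv ℝ (signedBoundaryDist Ω) x‖ ≤ 1 := by
  by_cases hd : DifferentiableAt ℝ (signedBoundaryDist Ω) x
  swap
  · simp [fderiv_zero_of_not_differentiableAt hd]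
  refine hd.hasFDerivAt.le_of_lip' zero_le_one ?_
  have hlip (y : Eucl n) : |Metric.infDist y (frontier Ω) - Metric.infDist x (frontier Ω)| ≤ ‖y - x‖ := by
    have := (Metric.lipschitz_infDist_pt (frontier Ω)).dist_le_mul y x
    simpa [Real.dist_eq, dist_eq_norm] using this
  by_cases hx : x ∈ frontier Ω
  · refine Eventually.of_forall fun y => ?_
    have := hlip y
    rw [Metric.infDist_zero_of_mem hx, sub_zero, ← abs_signedBoundaryDist, abs_abs] at this
    simpa [signedBoundaryDist_of_mem_frontier hx] using this
  · by_cases hxΩ : x ∈ Ω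
    · have hi : Ω ∈ 𝓝 x := by
        rw [← mem_interior_iff_mem_nhds]
        by_contra h
        exact hx ⟨subset_closure hxΩ, h⟩
      filter_upwards [hi] with y hy
      rw [signedBoundaryDist, signedBoundaryDist, if_pos hy, if_pos hxΩ, Real.norm_eq_abs,
        neg_sub_neg, abs_sub_comm, one_mul]
      exact hlip y
    · have hi : (closure Ω)ᶜ ∈ 𝓝 x := isClosed_closure.isOpen_compl.mem_nhds fun h =>
        hx ⟨h, fun h' => hxΩ (interior_subset h')⟩
      filter_upwards [hi] with y hy
      rw [signedBoundaryDist, signedBoundaryDist, if_neg fun h => hy (subset_closure h),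
        if_neg hxΩ, Real.norm_eq_abs, one_mul]
      exact hlip y

lemma eventually_neg_of_hasDerivAt_neg {φ : ℝ → ℝ} {a : ℝ} (h : HasDerivAt φ a 0) (h0 : φ 0 = 0)
    (ha : a < 0) : ∀ᶠ s in 𝓝[>] (0 : ℝ), φ s < 0 := by
  have ht := h.tendsto_slope.mono_left (nhdsWithin_mono 0 fun s (hs : 0 < s) => hs.ne')
  filter_upwards [ht.eventually_lt_const ha, self_mem_nhdsWithin] with s hs (hpos : 0 < s)
  rw [slope_def_field, h0, sub_zero, sub_zero, div_lt_iff₀ hpos, zero_mul] at hs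
  exact hs

/-! ### Second-order growth along parabolas -/

section Parabola
variable {E : Type*} [NormedAddCommGroup E] [NormedSpace ℝ E]

/-- The parabola through `q` with velocity `v` and acceleration `2 • w`. -/
def parabola (q v w : E) (s : ℝ) : E := q + s • v + s ^ 2 • w

lemma parabola_zero (q v w : E) : parabola q v w 0 = q := by simp [parabola]

lemma hasDerivAt_parabola (q v w : E) (s : ℝ) :
    HasDerivAt (parabola q v w) (v + (2 * s) • w) s := by
  have h1 := ((hasDerivAt_id s).smul_const v).const_add q
  have h2 := ((hasDerivAt_id s).pow 2).smul_const w
  convert! h1.add h2 using 1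
  simp

lemma tendsto_parabola (q v w : E) : Tendsto (parabola q v w) (𝓝 0) (𝓝 q) := by
  simpa [parabola_zero] using (hasDerivAt_parabola q v w 0).continuousAt.tendsto

lemma exists_mul_sq_le_comp_parabola {f : E → ℝ} {q v w : E} (hf : ContDiffAt ℝ 2 f q)
    (h0 : f q = 0) (h1 : fderiv ℝ f q v = 0)
    (h2 : 0 < fderiv ℝ (fderiv ℝ f) q v v + 2 * fderiv ℝ f q w) :
    ∃ ε > 0, ∀ᶠ s in 𝓝 (0 : ℝ), ε * s ^ 2 ≤ f (parabola q v w s) := by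
  set a := fderiv ℝ (fderiv ℝ f) q v v + 2 * fderiv ℝ f q w with ha
  -- `a` is the second derivative of `f` along the parabola at 0; subtracting `a / 4 * s ^ 2` leaves
  -- `a / 2 > 0`, so `φ` still has a local minimum.
  set φ : ℝ → ℝ := fun s => f (parabola q v w s) - a / 4 * s ^ 2 with hφ
  have hdiff : ∀ᶠ x in 𝓝 q, DifferentiableAt ℝ f x := by
    filter_upwards [hf.eventually (by simp)] with x hx using hx.differentiableAt (by norm_num)
  have hderiv : deriv φ =ᶠ[𝓝 0] fun s =>
      fderiv ℝ f (parabola q v w s) (v + (2 * s) • w) - a / 2 * s := by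
    filter_upwards [(tendsto_parabola q v w).eventually hdiff] with s hs
    have h := (hs.hasFDerivAt.comp_hasDerivAt s (hasDerivAt_parabola q v w s)).sub
      (((hasDerivAt_id s).pow 2).const_mul (a / 4))
    have h := h.deriv
    refine Eq.trans h ?_
    simp
    ring
  have hd : DifferentiableAt ℝ (fderiv ℝ f) q :=
    (hf.fderiv_right (m := 1) (by norm_num)).differentiableAt (by norm_num)
  have hdd : deriv (deriv φ) 0 = a / 2 := by
    rw [hderiv.deriv_eq]
    have hd' : HasFDerivAt (fderiv ℝ f) (fderiv ℝ (fderiv ℝ f) q) (parabola q v w 0) := by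
      rw [parabola_zero]; exact hd.hasFDerivAt
    have hA := hd'.comp_hasDerivAt (0 : ℝ) (hasDerivAt_parabola q v w 0)
    have hB : HasDerivAt (fun s : ℝ => v + (2 * s) • w) ((2 : ℝ) • w) 0 := by
      have := (((hasDerivAt_id (0 : ℝ)).const_mul 2).smul_const w).const_add v
      simpa using this
    have h := (hA.clm_apply hB).sub ((hasDerivAt_id (0 : ℝ)).const_mul (a / 2))
    refine h.deriv.trans ?_
    simp [parabola_zero]
    ring
  have hmin : IsLocalMin φ 0 := by
    refine isLocalMin_of_deriv_deriv_pos (by rw [hdd]; positivity) ?_ ?_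
    · rw [hderiv.eq_of_nhds]; simp [parabola_zero, h1]
    · have : ContinuousAt (fun s => f (parabola q v w s)) 0 := by
        refine ContinuousAt.comp (g := f) ?_ (hasDerivAt_parabola q v w 0).continuousAt
        rw [parabola_zero]; exact hf.continuousAt
      exact this.sub (by fun_prop)
  refine ⟨a / 4, by positivity, ?_⟩
  filter_upwards [hmin] with s hs
  simp only [hφ, parabola_zero, h0] at hs
  linarith

end Parabola

/-! ### Normal coordinates -/

section NormalCoordinates
variable {E : Type*} [NormedAddCommGroup E] [InnerProductSpace ℝ E] [CompleteSpace E]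

lemma ContDiff.gradient_infty {r : E → ℝ} (hr : ContDiff ℝ ∞ r) : ContDiff ℝ ∞ (gradient r) :=
  (InnerProductSpace.toDual ℝ E).symm.contDiff.comp (hr.fderiv_right (m := ∞) (by simp))

lemma inner_gradient_eq_fderiv (r : E → ℝ) (x v : E) : inner ℝ (gradient r x) v = fderiv ℝ r x v := by
  simp [gradient]

/-- Moves `y` by `t` times the gradient of `r` and records the level `r y`. -/
noncomputable def normalMap (r : E → ℝ) (z : E × ℝ) : E × ℝ := (z.1 + z.2 • gradient r z.1, r z.1)

lemma contDiff_normalMap {r : E → ℝ} (hr : ContDiff ℝ ∞ r) : ContDiff ℝ ∞ (normalMap r) :=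
  (contDiff_fst.add (contDiff_snd.smul (hr.gradient_infty.comp contDiff_fst))).prodMk
    (hr.comp contDiff_fst)

lemma exists_equiv_hasFDerivAt_normalMap [FiniteDimensional ℝ E] {r : E → ℝ} {p : E}
    (hr : ContDiff ℝ ∞ r) (hp : gradient r p ≠ 0) :
    ∃ A : (E × ℝ) ≃L[ℝ] (E × ℝ), HasFDerivAt (normalMap r) (A : (E × ℝ) →L[ℝ] (E × ℝ)) (p, 0) := by
  have hg : HasFDerivAt (gradient r) (fderiv ℝ (gradient r) p) (p, (0 : ℝ)).1 :=
    (hr.gradient_infty.differentiable (by simp) p).hasFDerivAt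
  have hr' : HasFDerivAt r (fderiv ℝ r p) (p, (0 : ℝ)).1 :=
    (hr.differentiable (by simp) p).hasFDerivAt
  have h := (hasFDerivAt_fst.add (hasFDerivAt_snd.smul (hg.comp (p, (0 : ℝ)) hasFDerivAt_fst))).prodMk
    (hr'.comp (p, (0 : ℝ)) hasFDerivAt_fst)
  set L := fderiv ℝ (normalMap r) (p, 0) with hL
  have hLapp (η : E) (τ : ℝ) : L (η, τ) = (η + τ • gradient r p, fderiv ℝ r p η) := by
    have : L = _ := HasFDerivAt.fderiv h
    rw [this]
    simp
  have hinj : Function.Injective L := by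
    rw [injective_iff_map_eq_zero]
    rintro ⟨η, τ⟩ h0
    rw [hLapp, Prod.mk_eq_zero] at h0
    obtain ⟨h1, h2⟩ := h0
    have hη : η = -(τ • gradient r p) := eq_neg_of_add_eq_zero_left h1
    rw [← inner_gradient_eq_fderiv, hη, inner_neg_right, inner_smul_right, neg_eq_zero,
      mul_eq_zero, inner_self_eq_zero] at h2
    have hτ : τ = 0 := h2.resolve_right hp
    simp [hη, hτ]
  refine ⟨(LinearEquiv.ofInjectiveEndo (L : (E × ℝ) →ₗ[ℝ] (E × ℝ)) hinj).toContinuousLinearEquiv, ?_⟩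
  have : (((LinearEquiv.ofInjectiveEndo (L : (E × ℝ) →ₗ[ℝ] (E × ℝ)) hinj).toContinuousLinearEquiv :
      (E × ℝ) ≃L[ℝ] (E × ℝ)) : (E × ℝ) →L[ℝ] (E × ℝ)) = L := by
    exact ContinuousLinearMap.ext fun _ => rfl
  rw [this]
  exact ((contDiff_normalMap hr).differentiable (by simp) _).hasFDerivAt

/-- A smooth local inverse of `normalMap r`, near a point of nonvanishing gradient. -/
lemma exists_smooth_local_inverse_normalMap [FiniteDimensional ℝ E] {r : E → ℝ} {p : E}
    (hr : ContDiff ℝ ∞ r) (hp : gradient r p ≠ 0) :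
    ∃ g : E × ℝ → E × ℝ, (∀ᶠ z in 𝓝 (p, (0 : ℝ)), g (normalMap r z) = z) ∧
      ∀ᶠ w in 𝓝 (p, r p), ContDiffAt ℝ ∞ g w := by
  obtain ⟨A, hA⟩ := exists_equiv_hasFDerivAt_normalMap hr hp
  have hN := contDiff_normalMap hr
  let e := hN.contDiffAt.toOpenPartialHomeomorph (normalMap r) hA (by simp)
  have he : (e : E × ℝ → E × ℝ) = normalMap r := rfl
  have hs : (p, (0 : ℝ)) ∈ e.source :=
    hN.contDiffAt.mem_toOpenPartialHomeomorph_source hA (by simp)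
  have hep : e (p, (0 : ℝ)) = (p, r p) := by simp [he, normalMap]
  have ht : (p, r p) ∈ e.target := hep ▸ e.map_source hs
  have hsymm : e.symm (p, r p) = (p, 0) := by rw [← hep, e.left_inv hs]
  refine ⟨e.symm, e.eventually_left_inverse hs, ?_⟩
  have hc : Continuous (fderiv ℝ (normalMap r)) := hN.continuous_fderiv (by simp)
  -- `C^∞` at one point need not spread to a neighborhood; invertibility of the derivative is open,
  -- so the inverse is smooth at every nearby point.
  have hinv : ∀ᶠ z in 𝓝 (p, (0 : ℝ)), fderiv ℝ (normalMap r) z ∈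
      Set.range ((↑) : ((E × ℝ) ≃L[ℝ] (E × ℝ)) → (E × ℝ) →L[ℝ] (E × ℝ)) := by
    refine hc.continuousAt.eventually_mem ?_
    rw [hA.fderiv]
    exact ContinuousLinearEquiv.nhds A
  have hcs : Tendsto e.symm (𝓝 (p, r p)) (𝓝 (p, 0)) := by
    simpa [hsymm] using (e.continuousAt_symm ht).tendsto
  filter_upwards [e.open_target.mem_nhds ht, hcs.eventually hinv] with w hw ⟨B, hB⟩
  refine e.contDiffAt_symm hw (f₀' := B) ?_ hN.contDiffAt
  rw [hB]
  exact (hN.differentiable (by simp) _).hasFDerivAt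

/-- Lagrange multipliers for the distance to a level set. -/
lemma exists_sub_eq_smul_gradient {r : E → ℝ} {x z : E} (hr : ContDiff ℝ ∞ r)
    (hz : gradient r z ≠ 0) (hmin : ∀ y, r y = r z → dist x z ≤ dist x y) :
    ∃ t : ℝ, x - z = t • gradient r z := by
  have hφ : HasStrictFDerivAt (fun y => ‖y - x‖ ^ 2)
      ((2 • innerSL ℝ (z - x)) ∘L ContinuousLinearMap.id ℝ E) z :=
    (hasStrictFDerivAt_norm_sq (z - x)).comp z ((hasStrictFDerivAt_id z).sub_const x)
  have hext : IsLocalExtrOn (fun y => ‖y - x‖ ^ 2) {y | r y = r z} z := by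
    refine Or.inl (eventually_nhdsWithin_of_forall fun y hy => ?_)
    have := hmin y hy
    rw [dist_comm x z, dist_comm x y, dist_eq_norm, dist_eq_norm] at this
    exact pow_le_pow_left₀ (norm_nonneg _) this 2
  obtain ⟨a, b, hab, h⟩ := hext.exists_multipliers_of_hasStrictFDerivAt_1d
    (hr.contDiffAt.hasStrictFDerivAt (by simp)) hφ
  have h' : a • gradient r z + (2 * b) • (z - x) = 0 := by
    refine ext_inner_right ℝ fun v => ?_
    have := DFunLike.congr_fun h v
    simp only [add_apply, smul_apply, ContinuousLinearMap.comp_id, innerSL_apply_apply, smul_eq_mul,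
      ← inner_gradient_eq_fderiv, zero_apply, nsmul_eq_mul, Nat.cast_ofNat] at this
    rw [inner_add_left, real_inner_smul_left, real_inner_smul_left, inner_zero_left]
    linarith
  have hb : b ≠ 0 := by
    rintro rfl
    have ha : a ≠ 0 := fun ha => hab (by simp [ha])
    simp [ha, hz] at h'
  refine ⟨a / (2 * b), ?_⟩
  have hb2 : 2 * b ≠ 0 := mul_ne_zero two_ne_zero hb
  rw [div_eq_inv_mul, mul_smul, eq_inv_smul_iff₀ hb2, ← neg_sub z x, smul_neg]
  exact (eq_neg_of_add_eq_zero_left h').symm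

end NormalCoordinates

/-! ### Smoothness of the signed distance -/

section SignedDistance
variable {n : ℕ} {Ω : Set (Eucl n)} {r : Eucl n → ℝ}

/-- Near a boundary point the signed distance is the length coordinate along the normals. -/
lemma exists_forall_signedBoundaryDist_eq {p : Eucl n} (hr : ContDiff ℝ ∞ r)
    (hΩ : Ω = {x | r x < 0}) (hfr : {x | r x = 0} = frontier Ω) (hp : p ∈ frontier Ω)
    (hgp : gradient r p ≠ 0) :
    ∃ ε > 0, ∀ x ∈ Metric.ball p ε, ∃ z t, r z = 0 ∧ dist z p ≤ 2 * dist x p ∧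
      |t| * ‖gradient r p‖ ≤ 2 * dist x p ∧ x = z + t • gradient r z ∧
      signedBoundaryDist Ω x = t * ‖gradient r z‖ := by
  have hgc : Continuous (gradient r) := hr.gradient_infty.continuous
  -- Nearby gradients make acute angles, so by the mean value theorem `r x` is `t` times a positive
  -- number; this fixes the sign of `t`.
  have hev : ∀ᶠ w in 𝓝 (p, p), 0 < inner ℝ (gradient r w.1) (gradient r w.2) := by
    refine ContinuousAt.eventually_lt continuousAt_const (Continuous.continuousAt (by fun_prop)) ?_
    exact real_inner_self_pos.2 hgp
  have hev2 : ∀ᶠ w in 𝓝 p, ‖gradient r p‖ / 2 < ‖gradient r w‖ :=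
    ContinuousAt.eventually_lt continuousAt_const (Continuous.continuousAt (by fun_prop))
      (half_lt_self (norm_pos_iff.2 hgp))
  obtain ⟨ε₁, hε₁, h₁⟩ := Metric.eventually_nhds_iff_ball.1 hev
  obtain ⟨ε₂, hε₂, h₂⟩ := Metric.eventually_nhds_iff_ball.1 hev2
  refine ⟨min ε₁ ε₂ / 2, by positivity, fun x hx => ?_⟩
  rw [Metric.mem_ball] at hx
  obtain ⟨z, hzF, hz⟩ := isClosed_frontier.exists_infDist_eq_dist ⟨p, hp⟩ x
  have hxz : dist x z ≤ dist x p := hz ▸ Metric.infDist_le_dist_of_mem hp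
  have hzp : dist z p ≤ 2 * dist x p := by
    have := dist_triangle_left z p x
    linarith
  have hrz : r z = 0 := by rwa [← hfr] at hzF
  have hxz₁ : x ∈ Metric.ball p ε₁ ∧ z ∈ Metric.ball p ε₁ := by
    simp only [Metric.mem_ball]
    have := min_le_left ε₁ ε₂
    constructor <;> linarith [dist_nonneg (x := x) (y := p)]
  have hz₂ : z ∈ Metric.ball p ε₂ := by
    simp only [Metric.mem_ball]
    linarith [min_le_right ε₁ ε₂]
  have hpair {a b : Eucl n} (ha : a ∈ Metric.ball p ε₁) (hb : b ∈ Metric.ball p ε₁) :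
      0 < inner ℝ (gradient r a) (gradient r b) := by
    refine h₁ (a, b) ?_
    rw [← ball_prod_same]
    exact ⟨ha, hb⟩
  have hgz : gradient r z ≠ 0 := fun h => by simpa [h] using hpair hxz₁.2 hxz₁.2
  obtain ⟨t, ht⟩ := exists_sub_eq_smul_gradient (x := x) hr hgz fun y hy => by
    rw [← hz]
    refine Metric.infDist_le_dist_of_mem ?_
    rw [← hfr]
    exact hy.trans hrz
  have hdist : dist x z = |t| * ‖gradient r z‖ := by rw [dist_eq_norm, ht, norm_smul, Real.norm_eq_abs]
  refine ⟨z, t, hrz, hzp, ?_, by rw [← ht]; abel, ?_⟩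
  · have := mul_le_mul_of_nonneg_left (h₂ z hz₂).le (abs_nonneg t)
    linarith
  obtain ⟨w, hw, hmv⟩ := domain_mvt (fun y _ => (hr.differentiable (by simp) y).hasFDerivAt.hasFDerivWithinAt)
    (convex_ball p ε₁) hxz₁.2 hxz₁.1
  have hwb : w ∈ Metric.ball p ε₁ := (convex_ball p ε₁).segment_subset hxz₁.2 hxz₁.1 hw
  rw [hrz, sub_zero, ht, map_smul, ← inner_gradient_eq_fderiv, smul_eq_mul] at hmv
  have hpos := hpair hwb hxz₁.2
  rw [signedBoundaryDist, hz, hdist]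
  split_ifs with hxΩ
  · have hneg : r x < 0 := by rwa [hΩ] at hxΩ
    have : t < 0 := by
      by_contra h
      exact hneg.not_ge (hmv ▸ mul_nonneg (not_lt.1 h) hpos.le)
    rw [abs_of_neg this]; ring
  · have hnn : 0 ≤ r x := by simpa [hΩ] using hxΩ
    have : 0 ≤ t := by
      by_contra h
      exact hnn.not_gt (hmv ▸ mul_neg_of_neg_of_pos (not_le.1 h) hpos)
    rw [abs_of_nonneg this]

/-- The nearest boundary point and its multiplier lie close to `(p, 0)` and are sent by `normalMap
r` to `(x, 0)`, so the local inverse recovers them. -/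
lemma eventually_signedBoundaryDist_eq {p : Eucl n} (hr : ContDiff ℝ ∞ r)
    (hΩ : Ω = {x | r x < 0}) (hfr : {x | r x = 0} = frontier Ω) (hp : p ∈ frontier Ω)
    (hgp : gradient r p ≠ 0) :
    ∃ g : Eucl n × ℝ → Eucl n × ℝ, (∀ᶠ z in 𝓝 (p, (0 : ℝ)), g (normalMap r z) = z) ∧
      (∀ᶠ w in 𝓝 (p, (0 : ℝ)), ContDiffAt ℝ ∞ g w) ∧
      ∀ᶠ x in 𝓝 p, signedBoundaryDist Ω x = (g (x, 0)).2 * ‖gradient r (g (x, 0)).1‖ := by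
  obtain ⟨g, hg, hgs⟩ := exists_smooth_local_inverse_normalMap hr hgp
  have hrp : r p = 0 := by rwa [← hfr] at hp
  rw [hrp] at hgs
  refine ⟨g, hg, hgs, ?_⟩
  obtain ⟨ε, hε, h⟩ := exists_forall_signedBoundaryDist_eq hr hΩ hfr hp hgp
  obtain ⟨η, hη, hη'⟩ := Metric.eventually_nhds_iff_ball.1 hg
  have hG : 0 < ‖gradient r p‖ := norm_pos_iff.2 hgp
  have hsmall : ∀ᶠ x in 𝓝 p, 2 * dist x p < min η (η * ‖gradient r p‖) := by
    refine ContinuousAt.eventually_lt (Continuous.continuousAt (by fun_prop)) continuousAt_const ?_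
    simp only [dist_self, mul_zero]
    positivity
  filter_upwards [Metric.ball_mem_nhds p hε, hsmall] with x hx hxs
  obtain ⟨z, t, hrz, hzp, htp, hxz, hδ⟩ := h x hx
  obtain ⟨h1, h2⟩ := lt_min_iff.1 hxs
  have hmem : (z, t) ∈ Metric.ball (p, (0 : ℝ)) η := by
    rw [← ball_prod_same]
    refine ⟨hzp.trans_lt h1, ?_⟩
    rw [Metric.mem_ball, dist_zero_right, Real.norm_eq_abs]
    exact lt_of_mul_lt_mul_right (htp.trans_lt h2) hG.le
  have hgx : g (x, 0) = (z, t) := by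
    have := hη' _ hmem
    rwa [normalMap, hrz, ← hxz] at this
  rw [hδ, hgx]

lemma eventually_contDiffAt_signedBoundaryDist {p : Eucl n} (hr : ContDiff ℝ ∞ r)
    (hΩ : Ω = {x | r x < 0}) (hfr : {x | r x = 0} = frontier Ω) (hp : p ∈ frontier Ω)
    (hgp : gradient r p ≠ 0) : ∀ᶠ x in 𝓝 p, ContDiffAt ℝ ∞ (signedBoundaryDist Ω) x := by
  obtain ⟨g, hg, hgs, h⟩ := eventually_signedBoundaryDist_eq hr hΩ hfr hp hgp
  have hgp0 : g (p, 0) = (p, 0) := by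
    have := hg.self_of_nhds
    rwa [normalMap, zero_smul, add_zero, show r p = 0 by rwa [← hfr] at hp] at this
  have hi : Tendsto (fun x : Eucl n => (x, (0 : ℝ))) (𝓝 p) (𝓝 (p, 0)) :=
    Continuous.tendsto (by fun_prop) p
  have hgc : ContinuousAt (fun x => gradient r (g (x, 0)).1) p := by
    have h1 : ContinuousAt (fun x => g (x, 0)) p :=
      ContinuousAt.comp (g := g) (hgs.self_of_nhds.continuousAt) hi
    exact hr.gradient_infty.continuous.continuousAt.comp h1.fst
  have hne : ∀ᶠ x in 𝓝 p, gradient r (g (x, 0)).1 ≠ 0 :=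
    hgc.eventually_ne (by simpa [hgp0] using hgp)
  filter_upwards [h.eventually_nhds, hi.eventually hgs, hne] with x hx hgx hnx
  refine ContDiffAt.congr_of_eventuallyEq ?_ hx
  have h1 : ContDiffAt ℝ ∞ (fun x => g (x, 0)) x :=
    ContDiffAt.comp (g := g) x hgx (contDiff_id.prodMk contDiff_const).contDiffAt
  exact h1.snd.mul ((hr.gradient_infty.contDiffAt.comp x h1.fst).norm ℝ hnx)

lemma eventually_signedBoundaryDist_add_smul_gradient {p : Eucl n} (hr : ContDiff ℝ ∞ r)
    (hΩ : Ω = {x | r x < 0}) (hfr : {x | r x = 0} = frontier Ω) (hp : p ∈ frontier Ω)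
    (hgp : gradient r p ≠ 0) :
    ∀ᶠ t in 𝓝 (0 : ℝ), signedBoundaryDist Ω (p + t • gradient r p) = t * ‖gradient r p‖ := by
  obtain ⟨g, hg, -, h⟩ := eventually_signedBoundaryDist_eq hr hΩ hfr hp hgp
  have hi : Tendsto (fun t : ℝ => (p, t)) (𝓝 0) (𝓝 (p, 0)) := Continuous.tendsto (by fun_prop) 0
  have hj : Tendsto (fun t : ℝ => p + t • gradient r p) (𝓝 0) (𝓝 p) := by
    have : Continuous fun t : ℝ => p + t • gradient r p := by fun_prop
    simpa using this.tendsto 0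
  filter_upwards [hi.eventually hg, hj.eventually h] with t h1 h2
  rw [normalMap, show r p = 0 by rwa [← hfr] at hp] at h1
  rw [h2, h1]

/-- The signed distance has derivative one along the unit normal. -/
lemma exists_unit_normal {p : Eucl n} (hr : ContDiff ℝ ∞ r)
    (hΩ : Ω = {x | r x < 0}) (hfr : {x | r x = 0} = frontier Ω) (hp : p ∈ frontier Ω)
    (hgp : gradient r p ≠ 0) :
    ∃ ν : Eucl n, ‖ν‖ = 1 ∧ fderiv ℝ (signedBoundaryDist Ω) p ν = 1 := by
  have hG : ‖gradient r p‖ ≠ 0 := norm_ne_zero_iff.2 hgp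
  refine ⟨‖gradient r p‖⁻¹ • gradient r p, by rw [norm_smul, norm_inv, norm_norm, inv_mul_cancel₀ hG], ?_⟩
  have hd := ((eventually_contDiffAt_signedBoundaryDist hr hΩ hfr hp hgp).self_of_nhds.differentiableAt
    (by simp)).hasFDerivAt
  have h1 := hd.hasLineDerivAt (gradient r p)
  have h2 : HasDerivAt (fun t : ℝ => t * ‖gradient r p‖) ‖gradient r p‖ 0 := by
    simpa using (hasDerivAt_id (0 : ℝ)).mul_const ‖gradient r p‖
  have h3 := HasDerivAt.unique h1
    (h2.congr_of_eventuallyEq (eventually_signedBoundaryDist_add_smul_gradient hr hΩ hfr hp hgp))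
  rw [map_smul, h3, smul_eq_mul, inv_mul_cancel₀ hG]

end SignedDistance

/-! ### The Hessian in the normal direction -/

/-- The derivative along `ν` never exceeds one, so it is maximal at `q` and is stationary there. -/
lemma fderiv_fderiv_eq_zero_of_fderiv_eq_one {E : Type*} [NormedAddCommGroup E] [NormedSpace ℝ E]
    {f : E → ℝ} {q ν : E} (hf : DifferentiableAt ℝ (fderiv ℝ f) q) (hle : ∀ x, ‖fderiv ℝ f x‖ ≤ 1)
    (hν : ‖ν‖ = 1) (h1 : fderiv ℝ f q ν = 1) (ξ : E) : fderiv ℝ (fderiv ℝ f) q ξ ν = 0 := by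
  have hmax : IsLocalMax (fun x => fderiv ℝ f x ν) q := Eventually.of_forall fun x => by
    simp only [h1]
    calc fderiv ℝ f x ν ≤ ‖fderiv ℝ f x‖ * ‖ν‖ := (le_abs_self _).trans ((fderiv ℝ f x).le_opNorm ν)
      _ ≤ 1 := by rw [hν, mul_one]; exact hle x
  have h := hmax.hasFDerivAt_eq_zero (hf.hasFDerivAt.clm_apply (hasFDerivAt_const ν q))
  simpa using DFunLike.congr_fun h ξ

/-! ### Comparing two functions through their negativity sets -/

section SameSign
variable {E : Type*} [NormedAddCommGroup E] [NormedSpace ℝ E] {f g : E → ℝ} {q : E}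

lemma fderiv_nonpos_of_fderiv_neg (hf : DifferentiableAt ℝ f q) (hg : DifferentiableAt ℝ g q)
    (hf0 : f q = 0) (hg0 : g q = 0) (h : ∀ᶠ x in 𝓝 q, f x < 0 → g x < 0) {v : E}
    (hv : fderiv ℝ f q v < 0) : fderiv ℝ g q v ≤ 0 := by
  by_contra! hpos
  have hlf := hf.hasFDerivAt.hasLineDerivAt v
  have hlg := (hg.hasFDerivAt.hasLineDerivAt v).neg
  have h1 := eventually_neg_of_hasDerivAt_neg hlf (by simpa using hf0) hv
  have h2 := eventually_neg_of_hasDerivAt_neg hlg (by simpa using hg0) (neg_neg_of_pos hpos)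
  have hc : Tendsto (fun t : ℝ => q + t • v) (𝓝[>] 0) (𝓝 q) := by
    have : Continuous fun t : ℝ => q + t • v := by fun_prop
    simpa using (this.tendsto 0).mono_left nhdsWithin_le_nhds
  obtain ⟨t, ht1, ht2, ht3⟩ := (h1.and (h2.and (hc.eventually h))).exists
  have := ht3 ht1
  simp only [Pi.neg_apply] at ht2
  linarith

/-- Tilting `v` by `-ε • ν` makes the inequality strict; then `ε → 0`. -/
lemma fderiv_nonpos_of_fderiv_nonpos (hf : DifferentiableAt ℝ f q) (hg : DifferentiableAt ℝ g q)
    (hf0 : f q = 0) (hg0 : g q = 0) (h : ∀ᶠ x in 𝓝 q, f x < 0 → g x < 0) {ν : E}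
    (hν : fderiv ℝ f q ν = 1) {v : E} (hv : fderiv ℝ f q v ≤ 0) : fderiv ℝ g q v ≤ 0 := by
  have hlim : Tendsto (fun ε : ℝ => fderiv ℝ g q (v - ε • ν)) (𝓝[>] 0) (𝓝 (fderiv ℝ g q v)) := by
    have : Continuous fun ε : ℝ => fderiv ℝ g q (v - ε • ν) := by fun_prop
    simpa using (this.tendsto 0).mono_left nhdsWithin_le_nhds
  refine le_of_tendsto hlim ?_
  filter_upwards [self_mem_nhdsWithin] with ε (hε : 0 < ε)
  refine fderiv_nonpos_of_fderiv_neg hf hg hf0 hg0 h ?_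
  rw [map_sub, map_smul, hν, smul_eq_mul]
  linarith

lemma fderiv_eq_zero_of_fderiv_eq_zero (hf : DifferentiableAt ℝ f q) (hg : DifferentiableAt ℝ g q)
    (hf0 : f q = 0) (hg0 : g q = 0) (h : ∀ᶠ x in 𝓝 q, f x < 0 → g x < 0) {ν : E}
    (hν : fderiv ℝ f q ν = 1) {v : E} (hv : fderiv ℝ f q v = 0) : fderiv ℝ g q v = 0 := by
  refine le_antisymm (fderiv_nonpos_of_fderiv_nonpos hf hg hf0 hg0 h hν hv.le) ?_
  have := fderiv_nonpos_of_fderiv_nonpos hf hg hf0 hg0 h hν (v := -v) (by simp [hv])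
  simpa using this

/-- The derivative of `g` vanishes on the kernel of that of `f`; if it also vanished on `ν` it would
be zero. -/
lemma fderiv_pos_of_fderiv_eq_one (hf : DifferentiableAt ℝ f q) (hg : DifferentiableAt ℝ g q)
    (hf0 : f q = 0) (hg0 : g q = 0) (h : ∀ᶠ x in 𝓝 q, f x < 0 → g x < 0) {ν : E}
    (hν : fderiv ℝ f q ν = 1) (hne : fderiv ℝ g q ≠ 0) : 0 < fderiv ℝ g q ν := by
  refine lt_of_le_of_ne ?_ fun h0 => hne ?_
  · have := fderiv_nonpos_of_fderiv_nonpos hf hg hf0 hg0 h hν (v := -ν) (by simp [hν])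
    simpa using this
  · ext v
    have := fderiv_eq_zero_of_fderiv_eq_zero hf hg hf0 hg0 h hν (v := v - fderiv ℝ f q v • ν)
      (by simp [hν])
    simpa [← h0] using this

/-- Tangential nonnegativity of the Hessian passes from `g` to `f` when `{f < 0} ⊆ {g < 0}`. -/
lemma fderiv_fderiv_nonneg_of_tangential (hf : ContDiffAt ℝ 2 f q) (hg : ContDiffAt ℝ 2 g q)
    (hf0 : f q = 0) (hg0 : g q = 0) (h : ∀ᶠ x in 𝓝 q, f x < 0 → g x < 0) {ν : E}
    (hν : fderiv ℝ f q ν = 1) (hne : fderiv ℝ g q ≠ 0) {v : E} (hv : fderiv ℝ f q v = 0)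
    (hgv : 0 ≤ fderiv ℝ (fderiv ℝ g) q v v) : 0 ≤ fderiv ℝ (fderiv ℝ f) q v v := by
  by_contra! hneg
  -- With acceleration `2 • (b / 4) • ν`, the second derivative of `f` along the parabola is `-b + b
  -- / 2 < 0`, while that of `g` is positive.
  set b := -fderiv ℝ (fderiv ℝ f) q v v with hb
  have hfd := hf.differentiableAt (by norm_num)
  have hgd := hg.differentiableAt (by norm_num)
  have hgν := fderiv_pos_of_fderiv_eq_one hfd hgd hf0 hg0 h hν hne
  have hbpos : 0 < b := by linarith
  obtain ⟨ε, hε, h1⟩ := exists_mul_sq_le_comp_parabola (w := (b / 4) • ν) hg hg0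
    (fderiv_eq_zero_of_fderiv_eq_zero hfd hgd hf0 hg0 h hν hv) (by
      rw [map_smul, smul_eq_mul]
      positivity)
  have hfn : fderiv ℝ (-f) = -fderiv ℝ f := by ext1 x; exact fderiv_neg
  obtain ⟨ε', hε', h2⟩ := exists_mul_sq_le_comp_parabola (f := -f) (v := v) (w := (b / 4) • ν) hf.neg
    (by simp [hf0]) (by simp [hfn, hv]) (by
      rw [hfn, fderiv_neg, map_smul]
      simp only [neg_apply, Pi.neg_apply, hν, smul_eq_mul]
      linarith)
  have h3 := (tendsto_parabola q v ((b / 4) • ν)).eventually h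
  obtain ⟨s, ⟨hs1, hs2, hs3⟩, hs⟩ :=
    (((h1.and (h2.and h3)).filter_mono nhdsWithin_le_nhds).and
      (self_mem_nhdsWithin : {0}ᶜ ∈ 𝓝[≠] (0 : ℝ))).exists
  have hs0 : 0 < s ^ 2 := by have : s ≠ 0 := hs; positivity
  simp only [Pi.neg_apply] at hs2
  nlinarith [hs3 (by nlinarith), mul_pos hε hs0]

end SameSign

/-- A local defining function is only prescribed by where it is negative: `ρ q < 0` would put `q` in
the open set `Ω`, and `ρ q > 0` would keep `Ω` away from `q`. -/
lemma eq_zero_of_mem_frontier {n : ℕ} {Ω U : Set (Eucl n)} {ρ : Eucl n → ℝ} {q : Eucl n}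
    (hΩ : IsOpen Ω) (hU : IsOpen U) (hq : q ∈ frontier Ω) (hqU : q ∈ U)
    (hρ : ContinuousAt ρ q) (hdef : Ω ∩ U = {x | x ∈ U ∧ ρ x < 0}) : ρ q = 0 := by
  have hqΩ : q ∉ Ω := fun h => hq.2 (by rwa [hΩ.interior_eq])
  refine le_antisymm ?_ (not_lt.1 fun h => hqΩ ?_)
  · by_contra! hpos
    obtain ⟨x, ⟨hx1, hx2⟩, hxΩ⟩ := mem_closure_iff_nhds.1 hq.1 _
      (inter_mem (hρ.eventually_const_lt hpos) (hU.mem_nhds hqU))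
    have : x ∈ Ω ∩ U := ⟨hxΩ, hx2⟩
    rw [hdef] at this
    exact lt_asymm this.2 hx1
  · have : q ∈ Ω ∩ U := by rw [hdef]; exact ⟨hqU, h⟩
    exact this.1

theorem corollaryC (n : ℕ) (Ω U : Set (Eucl n)) (p : Eucl n)
    (hΩ : IsSmoothlyBounded Ω) (hp : p ∈ frontier Ω)
    (hU : IsOpen U) (hpU : p ∈ U) (hconv : IsConvexDomainIn Ω U) :
    (∃ V : Set (Eucl n), IsOpen V ∧ frontier Ω ∩ U ⊆ V ∧ ContDiffOn ℝ ∞ (signedBoundaryDist Ω) V) ∧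
      ∀ x ∈ frontier Ω ∩ U, ∀ ξ : Eucl n, 0 ≤ realHessian (signedBoundaryDist Ω) ξ ξ x := by
  obtain ⟨hΩo, r, hr, hΩr, hfr, W, -, hFW, hW⟩ := hΩ
  obtain ⟨ρ, ⟨hρ, hdef, hgρ⟩, hH⟩ := hconv
  have hsm {q : Eucl n} (hq : q ∈ frontier Ω) :
      ∀ᶠ x in 𝓝 q, ContDiffAt ℝ ∞ (signedBoundaryDist Ω) x :=
    eventually_contDiffAt_signedBoundaryDist hr hΩr hfr hq (hW q (hFW hq))
  refine ⟨⟨interior {x | ContDiffAt ℝ ∞ (signedBoundaryDist Ω) x}, isOpen_interior,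
    fun q hq => mem_interior_iff_mem_nhds.2 (hsm hq.1),
    fun x hx => (Set.mem_ofPred.1 (interior_subset hx)).contDiffWithinAt⟩, ?_⟩
  rintro q ⟨hq, hqU⟩ ξ
  have hδ2 : ContDiffAt ℝ 2 (signedBoundaryDist Ω) q :=
    (hsm hq).self_of_nhds.of_le (WithTop.coe_le_coe.2 (le_top : (2 : ℕ∞) ≤ ⊤))
  have hρ2 : ContDiffAt ℝ 2 ρ q :=
    (hρ.contDiffAt (hU.mem_nhds hqU)).of_le (WithTop.coe_le_coe.2 (le_top : (2 : ℕ∞) ≤ ⊤))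
  have hρ0 := eq_zero_of_mem_frontier hΩo hU hq hqU hρ2.continuousAt hdef
  have hsub : ∀ᶠ x in 𝓝 q, signedBoundaryDist Ω x < 0 → ρ x < 0 := by
    filter_upwards [hU.mem_nhds hqU] with x hxU hx
    have : x ∈ Ω ∩ U := ⟨mem_of_signedBoundaryDist_neg hx, hxU⟩
    rw [hdef] at this
    exact this.2
  obtain ⟨ν, hν, hδν⟩ := exists_unit_normal hr hΩr hfr hq (hW q (hFW hq))
  have hδ0 := signedBoundaryDist_of_mem_frontier hq
  have hdδ : DifferentiableAt ℝ (fderiv ℝ (signedBoundaryDist Ω)) q :=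
    (hδ2.fderiv_right (m := 1) (by norm_num)).differentiableAt (by norm_num)
  have hker := fderiv_fderiv_eq_zero_of_fderiv_eq_one hdδ
    (norm_fderiv_signedBoundaryDist_le_one Ω) hν hδν
  have hsymm := hδ2.isSymmSndFDerivAt (by simp)
  -- Tangential part of `ξ`; the normal part contributes nothing, in either slot by symmetry.
  set τ := ξ - fderiv ℝ (signedBoundaryDist Ω) q ξ • ν with hτ
  have hδτ : fderiv ℝ (signedBoundaryDist Ω) q τ = 0 := by simp [hτ, hδν]
  have hρne : fderiv ℝ ρ q ≠ 0 := fun h => hgρ q ⟨hq, hqU⟩ (by simp [gradient, h])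
  have hρτ := fderiv_eq_zero_of_fderiv_eq_zero (hδ2.differentiableAt (by norm_num))
    (hρ2.differentiableAt (by norm_num)) hδ0 hρ0 hsub hδν hδτ
  have hmain : 0 ≤ fderiv ℝ (fderiv ℝ (signedBoundaryDist Ω)) q τ τ := by
    refine fderiv_fderiv_nonneg_of_tangential hδ2 hρ2 hδ0 hρ0 hsub hδν hρne hδτ ?_
    rw [← realHessian_eq_fderiv_fderiv hρ2]
    exact hH q ⟨hqU, hq⟩ τ ((inner_gradient_eq_fderiv ρ q τ).trans hρτ)
  rw [realHessian_eq_fderiv_fderiv hδ2]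
  have hξ : ξ = τ + fderiv ℝ (signedBoundaryDist Ω) q ξ • ν := by simp [hτ]
  have hν0 (v : Eucl n) : fderiv ℝ (fderiv ℝ (signedBoundaryDist Ω)) q ν v = 0 :=
    (hsymm.eq ν v).trans (hker v)
  rw [hξ]
  simpa [hker, hν0] using hmain
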